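/- Let $X$ be a nonempty Hausdorff topological space, let $k\ge 1$, and let $\mathcal S=(f_i)_{i=1}^k$ be an iterated function system on $X$, i.e. a finite system of continuous maps $f_i:X\to X$. Let $\mathcal K(X)$ be the family of nonempty compact subsets of $X$ with the Vietoris topology, and for $K\in\mathcal K(X)$ put $\mathcal S(K)=\bigcup_{i=1}^k f_i(K)$. A set $A\in\mathcal K(X)$ is an attractor of $\mathcal S$ if $\mathcal S(A)=A$ and $\mathcal S^{(n)}(K)\to A$ for every $K\in\mathcal K(X)$. The system $\mathcal S$ is topologically contracting if every $K\in\mathcal K(X)$ is contained in some $D\in\mathcal K(X)$ with $\mathcal S(D)\subset D$, and if for every $D\in\mathcal K(X)$ with $\mathcal S(D)\subset D$ and every sequence $(\sigma_n)_{n\ge1}$ in $\{1,\dots,k\}$ the set $\bigcap_{n\ge 1} f_{\sigma_1}\circ\dots\circ f_{\sigma_n}(D)$ is a singleton. Let $\varrho=(\varrho_i)_{i=1}^k$ be an admissible system of grey level maps: each $\varrho_i:[0,1]\to[0,1]$ is nondecreasing and right continuous with $\varrho_i(0)=0$, and $\varrho_j(1)=1$ for some $j$. Let $\mathcal K_{\mathcal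 F}(X)$ be the family of compact fuzzy sets, i.e. of upper semicontinuous functions $u:X\to[0,1]$ that attain the value $1$ and whose support $[u]^0=\overline{\{x:u(x)>0\}}$ is compact. Endow it with the $h$-topology, induced by the map $u\mapsto \{(x,\alpha): x\in[u]^0,\ 0\le\alpha\le u(x)\}$ from the Vietoris topology on $\mathcal K(X\times[0,1])$. The fuzzy Hutchinson operator of $\mathcal S_{\mathcal F}=(\mathcal S,\varrho)$ is $\mathcal S_{\mathcal F}(u)=\max_{1\le i\le k}\varrho_i\circ f_i[u]$, where $f_i[u](y)=\sup\{u(x):f_i(x)=y\}$ (with $\sup\emptyset=0$). A compact fuzzy set $u_{\mathcal S}$ is a weak fuzzy attractor of $\mathcal S_{\mathcal F}$ if $\mathcal S_{\mathcal F}(u_{\mathcal S})=u_{\mathcal S}$ and $\mathcal S_{\mathcal F}^{(n)}(u)\to u_{\mathcal S}$ in the $h$-topology for every $u\in\mathcal K_{\mathcal F}(X)$. Suppose that $\mathcal S$ is topologically contracting and that $\varrho_i(1)=1$ for every $i=1,\dots,k$. Then $\mathcal S$ has a unique attractor $A_{\mathcal S}$, the fuzzy system $\mathcal S_{\mathcal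 F}$ has a unique weak fuzzy attractor $u_{\mathcal S}$, and $$u_{\mathcal S}=\chi_{A_{\mathcal S}},$$ the characteristic function of $A_{\mathcal S}$. -/

import Mathlib

open Set Filter Topology TopologicalSpace unitInterval

noncomputable section

namespace FuzzyIFSTheory

/-! ### Iterated function systems, attractors, topological contractivity -/

/-- An iterated function system `(f_1, …, f_k)` of continuous selfmaps of `X`
(`X` is Hausdorff and `k` is positive wherever this is used). -/
structure IFS (X : Type*) [TopologicalSpace X] (k : ℕ) where
  map : Fin k → X → X
  continuous_map : ∀ i, Continuous (map i)

namespace IFS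

variable {X : Type*} [TopologicalSpace X] {k : ℕ}

/-- The Hutchinson operator `K ↦ ⋃ i, f_i(K)` on the nonempty compact subsets of `X`. -/
def hutchinson [NeZero k] (S : IFS X k) (K : NonemptyCompacts X) : NonemptyCompacts X where
  carrier := ⋃ i, S.map i '' (K : Set X)
  isCompact' := isCompact_iUnion fun i => K.isCompact.image (S.continuous_map i)
  nonempty' := nonempty_iUnion.2 ⟨0, K.nonempty.image _⟩

/-- `A` is an attractor: it is invariant, and for every `K` the iterates `S^(n)(K)` converge to `A`
in the Vietoris topology (the topology that Mathlib puts on `NonemptyCompacts X`). -/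
def IsAttractor [NeZero k] (S : IFS X k) (A : NonemptyCompacts X) : Prop :=
  A = S.hutchinson A ∧
    ∀ K : NonemptyCompacts X, Tendsto (fun n : ℕ => S.hutchinson^[n] K) atTop (𝓝 A)

/-- Every nonempty compact set lies in a subinvariant nonempty compact set. -/
def CompactlyDominating [NeZero k] (S : IFS X k) : Prop :=
  ∀ K : NonemptyCompacts X, ∃ D : NonemptyCompacts X,
    (K : Set X) ⊆ D ∧ (S.hutchinson D : Set X) ⊆ D

/-- `S.word s n = f_{s_1} ∘ ⋯ ∘ f_{s_n}`; the sequence `s_1, s_2, …` is indexed from `0`. -/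
def word (S : IFS X k) (s : ℕ → Fin k) : ℕ → X → X
  | 0 => id
  | n + 1 => S.word s n ∘ S.map (s n)

/-- Topological contractivity: compact dominancy, and all the fibres
`⋂_{n ≥ 1} f_{s_1} ∘ ⋯ ∘ f_{s_n} (D)` over subinvariant compact sets `D` are singletons. -/
def TopologicallyContracting [NeZero k] (S : IFS X k) : Prop :=
  S.CompactlyDominating ∧
    ∀ D : NonemptyCompacts X, (S.hutchinson D : Set X) ⊆ D →
      ∀ s : ℕ → Fin k, ∃ x : X, ⋂ n : ℕ, S.word s (n + 1) '' (D : Set X) = {x}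

end IFS

/-! ### Compact fuzzy sets and the topology of hypographs -/

/-- The space of compact fuzzy sets: normal, upper semicontinuous and compactly supported maps
`u : X → [0,1]`. -/
structure CompactFuzzySet (X : Type*) [TopologicalSpace X] where
  toFun : X → I
  normal : ∃ x, toFun x = 1
  usc : UpperSemicontinuous toFun
  compact_support : IsCompact (closure {x | 0 < toFun x})

namespace CompactFuzzySet

variable {X : Type*} [TopologicalSpace X]

/-- The support `[u]^0`, the closure of `{x | u x > 0}`. -/
def support (u : CompactFuzzySet X) : Set X := closure {x | 0 < u.toFun x}

/-- The hypograph `{(x, α) : x ∈ [u]^0, 0 ≤ α ≤ u x}`, a nonempty compact subset of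
`X × [0,1]`. -/
def hypo (u : CompactFuzzySet X) : NonemptyCompacts (X × I) where
  carrier := {p | p.1 ∈ u.support ∧ p.2 ≤ u.toFun p.1}
  isCompact' := by
    have h : {p : X × I | p.1 ∈ u.support ∧ p.2 ≤ u.toFun p.1} =
        (u.support ×ˢ (univ : Set I)) ∩ {p : X × I | p.2 ≤ u.toFun p.1} := by
      ext p
      simp
    rw [h]
    exact (u.compact_support.prod isCompact_univ).inter_right u.usc.IsClosed_hypograph
  nonempty' := by
    obtain ⟨x, hx⟩ := u.normal
    refine ⟨(x, 1), subset_closure ?_, hx.ge⟩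
    show 0 < u.toFun x
    rw [hx]
    exact zero_lt_one

/-- The `h`-topology: the topology induced by `u ↦ hypo u` from the Vietoris topology on the
nonempty compact subsets of `X × [0,1]`. -/
instance hTopology : TopologicalSpace (CompactFuzzySet X) :=
  TopologicalSpace.induced hypo inferInstance

end CompactFuzzySet

/-- Zadeh's image `f[u]`, where `f[u](y) = sup {u x : f x = y}`; the supremum is taken in `[0,1]`,
so that it is `0` if `y` is not in the range of `f`. -/
def fuzzyImage {X Y : Type*} (f : X → Y) (u : X → I) (y : Y) : I :=
  sSup (u '' (f ⁻¹' {y}))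

/-! ### Fuzzy iterated function systems -/

/-- A fuzzy iterated function system: an IFS with an admissible system of grey level maps. -/
structure FuzzyIFS (X : Type*) [TopologicalSpace X] (k : ℕ) extends IFS X k where
  grey : Fin k → I → I
  grey_right_continuous : ∀ i t, ContinuousWithinAt (grey i) (Ici t) t
  grey_monotone : ∀ i, Monotone (grey i)
  grey_zero : ∀ i, grey i 0 = 0
  exists_grey_one : ∃ j, grey j 1 = 1

namespace FuzzyIFS

variable {X : Type*} [TopologicalSpace X] {k : ℕ}

/-- The function `max_i ρ_i ∘ f_i[u]`. -/
def hutchinsonFun (S : FuzzyIFS X k) (u : X → I) (y : X) : I :=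
  ⨆ i, S.grey i (fuzzyImage (S.map i) u y)

theorem usc_grey_comp (S : FuzzyIFS X k) (i : Fin k) {u : X → I} (hu : UpperSemicontinuous u) :
    UpperSemicontinuous fun x => S.grey i (u x) := by
  intro x c hc
  have h1 : ∀ᶠ t in 𝓝[≥] (u x), S.grey i t < c :=
    (S.grey_right_continuous i (u x)).eventually (gt_mem_nhds hc)
  rcases (u x).2.2.lt_or_eq with hlt | heq
  · have hlt' : u x < 1 := hlt
    obtain ⟨b, hb, hsub⟩ := (mem_nhdsGE_iff_exists_Ico_subset' hlt').1 h1
    obtain ⟨t, ht1, ht2⟩ := exists_between (show u x < b from hb)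
    filter_upwards [hu x t ht1] with y hy
    exact (S.grey_monotone i hy.le).trans_lt (hsub ⟨ht1.le, ht2⟩)
  · have heq' : u x = 1 := Subtype.ext heq
    filter_upwards with y
    refine (S.grey_monotone i ?_).trans_lt hc
    rw [heq']
    exact (u y).2.2

theorem exists_fuzzyImage_eq [T2Space X] (u : CompactFuzzySet X) {f : X → X} (hf : Continuous f)
    {y : X} (h : 0 < fuzzyImage f u.toFun y) :
    ∃ x, f x = y ∧ u.toFun x = fuzzyImage f u.toFun y := by
  have hc : IsCompact (u.support ∩ f ⁻¹' {y}) :=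
    u.compact_support.inter_right (isClosed_singleton.preimage hf)
  obtain ⟨_, ⟨x₀, hx₀, rfl⟩, hpos⟩ := lt_sSup_iff.1 h
  have hne : (u.support ∩ f ⁻¹' {y}).Nonempty := ⟨x₀, subset_closure hpos, hx₀⟩
  obtain ⟨x, hx, hmax⟩ := (u.usc.upperSemicontinuousOn _).exists_isMaxOn hne hc
  refine ⟨x, hx.2, le_antisymm (le_sSup ⟨x, hx.2, rfl⟩) (sSup_le ?_)⟩
  rintro _ ⟨z, hz, rfl⟩
  by_cases hz0 : 0 < u.toFun z
  · exact hmax ⟨subset_closure hz0, hz⟩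
  · exact (not_lt.1 hz0).trans (u.toFun x).2.1

theorem le_hutchinsonFun_iff [T2Space X] (S : FuzzyIFS X k) (u : CompactFuzzySet X) {α : I}
    (hα : 0 < α) (y : X) :
    α ≤ S.hutchinsonFun u.toFun y ↔ ∃ i x, S.map i x = y ∧ α ≤ S.grey i (u.toFun x) := by
  constructor
  · intro h
    obtain ⟨j, -⟩ := S.exists_grey_one
    have : Nonempty (Fin k) := ⟨j⟩
    obtain ⟨i, hi⟩ := exists_eq_ciSup_of_finite (f := fun i =>
      S.grey i (fuzzyImage (S.map i) u.toFun y))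
    have hle : α ≤ S.grey i (fuzzyImage (S.map i) u.toFun y) := by
      rw [hi]
      exact h
    have hpos : 0 < fuzzyImage (S.map i) u.toFun y := by
      rcases (fuzzyImage (S.map i) u.toFun y).2.1.lt_or_eq with h0 | h0
      · exact h0
      · have h0' : fuzzyImage (S.map i) u.toFun y = 0 := Subtype.ext h0.symm
        rw [h0', S.grey_zero] at hle
        exact absurd hle (not_le.2 hα)
    obtain ⟨x, hx, hux⟩ := exists_fuzzyImage_eq u (S.continuous_map i) hpos
    exact ⟨i, x, hx, hux ▸ hle⟩
  · rintro ⟨i, x, rfl, h⟩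
    have hx : u.toFun x ≤ fuzzyImage (S.map i) u.toFun (S.map i x) := le_sSup ⟨x, rfl, rfl⟩
    exact (h.trans (S.grey_monotone i hx)).trans
      (le_iSup (fun j => S.grey j (fuzzyImage (S.map j) u.toFun (S.map i x))) i)

theorem subset_support_of_grey (S : FuzzyIFS X k) (u : CompactFuzzySet X) {α : I} (hα : 0 < α)
    (i : Fin k) : {x | α ≤ S.grey i (u.toFun x)} ⊆ u.support := by
  intro x hx
  refine subset_closure ?_
  rcases (u.toFun x).2.1.lt_or_eq with h0 | h0
  · exact h0
  · have h0' : u.toFun x = 0 := Subtype.ext h0.symm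
    have hx' : α ≤ S.grey i (u.toFun x) := hx
    rw [h0', S.grey_zero] at hx'
    exact absurd hx' (not_le.2 hα)

/-- The fuzzy Hutchinson operator `u ↦ max_i ρ_i ∘ f_i[u]` on the compact fuzzy sets of `X`. -/
def hutchinson [T2Space X] (S : FuzzyIFS X k) (u : CompactFuzzySet X) : CompactFuzzySet X where
  toFun := S.hutchinsonFun u.toFun
  normal := by
    obtain ⟨j, hj⟩ := S.exists_grey_one
    obtain ⟨x, hx⟩ := u.normal
    refine ⟨S.map j x, le_antisymm (S.hutchinsonFun u.toFun _).2.2 ?_⟩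
    exact (S.le_hutchinsonFun_iff u zero_lt_one _).2 ⟨j, x, rfl, by rw [hx, hj]⟩
  usc := by
    rw [upperSemicontinuous_iff_isClosed_preimage]
    intro α
    rcases α.2.1.lt_or_eq with h0 | h0
    · have hα : 0 < α := h0
      have h : S.hutchinsonFun u.toFun ⁻¹' Ici α =
          ⋃ i, S.map i '' {x | α ≤ S.grey i (u.toFun x)} := by
        ext y
        rw [mem_preimage, mem_Ici, S.le_hutchinsonFun_iff u hα]
        simp only [mem_iUnion, mem_image, mem_ofPred_eq]
        exact ⟨fun ⟨i, x, h1, h2⟩ => ⟨i, x, h2, h1⟩, fun ⟨i, x, h2, h1⟩ => ⟨i, x, h1, h2⟩⟩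
      rw [h]
      refine (isCompact_iUnion fun i => IsCompact.image ?_ (S.continuous_map i)).isClosed
      exact u.compact_support.of_isClosed_subset
        ((upperSemicontinuous_iff_isClosed_preimage.1 (S.usc_grey_comp i u.usc)) α)
        (S.subset_support_of_grey u hα i)
    · have hα : α = 0 := Subtype.ext h0.symm
      have h : S.hutchinsonFun u.toFun ⁻¹' Ici α = univ := by
        ext y
        simp [hα]
      rw [h]
      exact isClosed_univ
  compact_support := by
    have hK : IsCompact (⋃ i, S.map i '' u.support) :=
      isCompact_iUnion fun i => u.compact_support.image (S.continuous_map i)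
    refine hK.closure_of_subset fun y hy => ?_
    have hy' : 0 < S.hutchinsonFun u.toFun y := hy
    obtain ⟨i, x, hx, h⟩ := (S.le_hutchinsonFun_iff u hy' y).1 le_rfl
    exact mem_iUnion.2 ⟨i, x, S.subset_support_of_grey u hy' i h, hx⟩

/-- `u` is a weak fuzzy attractor: it is invariant, and for every compact fuzzy set `v` the
iterates of the fuzzy Hutchinson operator at `v` converge to `u` in the `h`-topology. -/
def IsWeakFuzzyAttractor [T2Space X] (S : FuzzyIFS X k) (u : CompactFuzzySet X) : Prop :=
  u = S.hutchinson u ∧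
    ∀ v : CompactFuzzySet X, Tendsto (fun n : ℕ => S.hutchinson^[n] v) atTop (𝓝 u)

end FuzzyIFS

/-- The characteristic function `χ_C`. -/
def charFun {X : Type*} (C : Set X) : X → I := indicator C fun _ => 1

end FuzzyIFSTheory

end

/-! The crisp attractor is the nested intersection of the iterates of a subinvariant compact `D`.
Compactness pushes the iterates into any neighbourhood of it. Conversely, each of its points has an
address whose cylinders shrink to that point, so the iterates of any nonempty compact `K ⊆ D`
approach it (`exists_tendsto_of_subset`). Since every grey level map fixes `1`, points of height `1`
are carried along by every map. The hypograph of the `n`-th iterate of `v` is thus squeezed between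
cylinders over the crisp orbits of a point of height `1` and of the support. Both tend to the
cylinder over the attractor, which is the hypograph of its characteristic function. Uniqueness holds
because the hyperspaces are Hausdorff. -/

namespace FuzzyIFSTheory

/-! ### Convergence in the Vietoris topology -/

section Vietoris

variable {X ι : Type*} [TopologicalSpace X] {l : Filter ι}

theorem tendsto_nonemptyCompacts_iff {F : ι → NonemptyCompacts X} {A : NonemptyCompacts X} :
    Tendsto F l (𝓝 A) ↔
      (∀ U : Set X, IsOpen U → (A : Set X) ⊆ U → ∀ᶠ n in l, (F n : Set X) ⊆ U) ∧
      ∀ V : Set X, IsOpen V → ((A : Set X) ∩ V).Nonempty →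
        ∀ᶠ n in l, ((F n : Set X) ∩ V).Nonempty := by
  constructor
  · exact fun h =>
      ⟨fun U hU hA => h.eventually
        ((NonemptyCompacts.isOpen_subsets_of_isOpen hU).mem_nhds hA),
      fun V hV hA => h.eventually
        ((NonemptyCompacts.isOpen_inter_nonempty_of_isOpen hV).mem_nhds hA)⟩
  · rintro ⟨h₁, h₂⟩
    -- The topology of `NonemptyCompacts X` is induced from this one on `Set X`, whose generators
    -- are the two families below.
    let _ := TopologicalSpace.vietoris X
    rw [nhds_induced, tendsto_comap_iff]
    refine TopologicalSpace.tendsto_nhds_generateFrom_iff.2 ?_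
    rintro _ (⟨U, hU, rfl⟩ | ⟨V, hV, rfl⟩) hA
    · exact h₁ U hU hA
    · exact h₂ V hV hA

/-- The squeeze theorem for the Vietoris topology. -/
theorem tendsto_nonemptyCompacts_of_subset_of_subset {F G H : ι → NonemptyCompacts X}
    {A : NonemptyCompacts X} (hF : Tendsto F l (𝓝 A)) (hH : Tendsto H l (𝓝 A))
    (hFG : ∀ n, (F n : Set X) ⊆ G n) (hGH : ∀ n, (G n : Set X) ⊆ H n) :
    Tendsto G l (𝓝 A) := by
  rw [tendsto_nonemptyCompacts_iff] at *
  refine ⟨fun U hU hA => ?_, fun V hV hA => ?_⟩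
  · filter_upwards [hH.1 U hU hA] with n hn using (hGH n).trans hn
  · filter_upwards [hF.2 V hV hA] with n hn using hn.mono (inter_subset_inter_left _ (hFG n))

end Vietoris

/-! ### The crisp attractor -/

namespace IFS

variable {X : Type*} [TopologicalSpace X] {k : ℕ}

theorem continuous_word (S : IFS X k) (s : ℕ → Fin k) (n : ℕ) : Continuous (S.word s n) := by
  induction n with
  | zero => exact continuous_id
  | succ n ih => exact ih.comp (S.continuous_map _)

variable [NeZero k]

theorem mem_hutchinson {S : IFS X k} {K : NonemptyCompacts X} {y : X} :
    y ∈ (S.hutchinson K : Set X) ↔ ∃ i, ∃ x ∈ (K : Set X), S.map i x = y :=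
  mem_iUnion

theorem hutchinson_mono (S : IFS X k) {K L : NonemptyCompacts X} (h : (K : Set X) ⊆ L) :
    (S.hutchinson K : Set X) ⊆ S.hutchinson L :=
  iUnion_mono fun _ => image_mono h

theorem hutchinson_iterate_mono (S : IFS X k) {K L : NonemptyCompacts X} (h : (K : Set X) ⊆ L)
    (n : ℕ) : (S.hutchinson^[n] K : Set X) ⊆ S.hutchinson^[n] L := by
  induction n with
  | zero => exact h
  | succ n ih =>
    simp only [Function.iterate_succ_apply']
    exact S.hutchinson_mono ih

theorem hutchinson_iterate_antitone (S : IFS X k) {D : NonemptyCompacts X}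
    (hD : (S.hutchinson D : Set X) ⊆ D) :
    Antitone fun n : ℕ => (S.hutchinson^[n] D : Set X) :=
  antitone_nat_of_succ_le fun n => by
    simp only [Function.iterate_succ_apply]
    exact S.hutchinson_iterate_mono hD n

theorem image_word_subset_iterate (S : IFS X k) (s : ℕ → Fin k) (n : ℕ)
    (K : NonemptyCompacts X) : S.word s n '' (K : Set X) ⊆ S.hutchinson^[n] K := by
  induction n generalizing K with
  | zero => simp [word]
  | succ n ih =>
    rw [Function.iterate_succ_apply, word, image_comp]
    exact (image_mono fun _ hy => mem_iUnion.2 ⟨s n, hy⟩).trans (ih (S.hutchinson K))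

theorem image_word_antitone (S : IFS X k) (s : ℕ → Fin k) {D : NonemptyCompacts X}
    (hD : (S.hutchinson D : Set X) ⊆ D) :
    Antitone fun n : ℕ => S.word s n '' (D : Set X) :=
  antitone_nat_of_succ_le fun n => by
    simp only [word, image_comp]
    exact image_mono fun _ hy => hD (mem_iUnion.2 ⟨s n, hy⟩)

/-- Every point of a set that is covered by its own images has an address. -/
theorem exists_address (S : IFS X k) {A : NonemptyCompacts X}
    (hA : (A : Set X) ⊆ S.hutchinson A) {a : X} (ha : a ∈ A) :
    ∃ s : ℕ → Fin k, ∀ n, a ∈ S.word s n '' (A : Set X) := by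
  have h : ∀ x : A, ∃ (i : Fin k) (y : A), S.map i y = x := fun x => by
    obtain ⟨i, y, hy, hyx⟩ := mem_hutchinson.1 (hA x.2)
    exact ⟨i, ⟨y, hy⟩, hyx⟩
  choose i g hg using h
  -- `g` selects a preimage inside `A`; the address of `a` is its itinerary under `g`.
  refine ⟨fun n => i (g^[n] ⟨a, ha⟩), fun n => ⟨g^[n] ⟨a, ha⟩, Subtype.coe_prop _, ?_⟩⟩
  induction n with
  | zero => rfl
  | succ n ih => rwa [Function.iterate_succ_apply', word, Function.comp_apply, hg]

variable [T2Space X]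

/-- The intersection of the iterates of a subinvariant compact set is invariant. -/
theorem exists_invariant_eq_iInter (S : IFS X k) {D : NonemptyCompacts X}
    (hD : (S.hutchinson D : Set X) ⊆ D) :
    ∃ A : NonemptyCompacts X, (A : Set X) = ⋂ n, (S.hutchinson^[n] D : Set X) ∧
      S.hutchinson A = A := by
  have hanti := S.hutchinson_iterate_antitone hD
  have hne : (⋂ n, (S.hutchinson^[n] D : Set X)).Nonempty :=
    IsCompact.nonempty_iInter_of_sequence_nonempty_isCompact_isClosed _
      (fun n => hanti n.le_succ) (fun n => (S.hutchinson^[n] D).nonempty)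
      (S.hutchinson^[0] D).isCompact fun n => (S.hutchinson^[n] D).isCompact.isClosed
  have hcl : IsClosed (⋂ n, (S.hutchinson^[n] D : Set X)) :=
    isClosed_iInter fun n => (S.hutchinson^[n] D).isCompact.isClosed
  let A : NonemptyCompacts X :=
    ⟨⟨⋂ n, (S.hutchinson^[n] D : Set X), D.isCompact.of_isClosed_subset hcl (iInter_subset _ 0)⟩,
      hne⟩
  have hA : (A : Set X) = ⋂ n, (S.hutchinson^[n] D : Set X) := rfl
  refine ⟨A, hA, SetLike.coe_injective (Subset.antisymm ?_ fun a ha => ?_)⟩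
  · rw [hA]
    refine subset_iInter fun n => ?_
    refine Subset.trans ?_ (hanti n.le_succ)
    simp only [Function.iterate_succ_apply']
    exact S.hutchinson_mono (hA ▸ iInter_subset _ n)
  -- If no `f_i` sends a point of `A` to `a`, the same holds, by compactness, for some iterate of
  -- `D`; but `a` lies in the next iterate.
  · by_contra hcon
    have hU : IsOpen (⋂ i, S.map i ⁻¹' {a}ᶜ) :=
      isOpen_iInter_of_finite fun i => isOpen_compl_singleton.preimage (S.continuous_map i)
    have hAU : (⋂ n, (S.hutchinson^[n] D : Set X)) ⊆ ⋂ i, S.map i ⁻¹' {a}ᶜ := fun x hx =>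
      mem_iInter.2 fun i hxa => hcon (mem_hutchinson.2 ⟨i, x, hx, hxa⟩)
    obtain ⟨n, hn⟩ := exists_subset_nhds_of_isCompact (directed_of_isDirected_le hanti)
      (fun n => (S.hutchinson^[n] D).isCompact) fun x hx => hU.mem_nhds (hAU hx)
    have han : a ∈ (S.hutchinson^[n + 1] D : Set X) := mem_iInter.1 ha (n + 1)
    rw [Function.iterate_succ_apply'] at han
    obtain ⟨i, x, hx, hxa⟩ := mem_hutchinson.1 han
    exact mem_iInter.1 (hn hx) i hxa

/-- The upper half of the convergence needs only compactness; contractivity enters in the lower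
half, through the singleton fibres. -/
theorem TopologicallyContracting.exists_tendsto_of_subset {S : IFS X k}
    (hS : S.TopologicallyContracting) {D : NonemptyCompacts X}
    (hD : (S.hutchinson D : Set X) ⊆ D) :
    ∃ A : NonemptyCompacts X, S.hutchinson A = A ∧ ∀ K : NonemptyCompacts X, (K : Set X) ⊆ D →
      Tendsto (fun n : ℕ => S.hutchinson^[n] K) atTop (𝓝 A) := by
  have hanti := S.hutchinson_iterate_antitone hD
  obtain ⟨A, hA, hinv⟩ := S.exists_invariant_eq_iInter hD
  refine ⟨A, hinv, fun K hK => tendsto_nonemptyCompacts_iff.2 ⟨fun U hU hAU => ?_, ?_⟩⟩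
  · obtain ⟨n, hn⟩ := exists_subset_nhds_of_isCompact (directed_of_isDirected_le hanti)
      (fun n => (S.hutchinson^[n] D).isCompact) fun x hx => hU.mem_nhds (hAU (hA ▸ hx))
    filter_upwards [eventually_ge_atTop n] with m hm
    exact (S.hutchinson_iterate_mono hK m).trans ((hanti hm).trans hn)
  · rintro V hV ⟨a, ha, haV⟩
    have hAD : (A : Set X) ⊆ D := hA ▸ iInter_subset _ 0
    obtain ⟨s, hs⟩ := S.exists_address (by rw [hinv]) ha
    have hword := S.image_word_antitone s hD
    obtain ⟨x, hx⟩ := hS.2 D hD s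
    -- The fibre along the address of `a` contains `a`, so it is `{a}`, and some cylinder of `D`
    -- lies in `V`.
    have hax : a = x := by
      have : a ∈ ⋂ n : ℕ, S.word s (n + 1) '' (D : Set X) :=
        mem_iInter.2 fun n => image_mono hAD (hs (n + 1))
      rwa [hx] at this
    obtain ⟨n, hn⟩ := exists_subset_nhds_of_isCompact (U := V)
      (V := fun n : ℕ => S.word s (n + 1) '' (D : Set X))
      (directed_of_isDirected_le fun m n hmn => hword (Nat.succ_le_succ hmn))
      (fun n => D.isCompact.image (S.continuous_word s _))
      fun y hy => hV.mem_nhds <| by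
        rw [hx, mem_singleton_iff] at hy
        rwa [hy, ← hax]
    filter_upwards [eventually_ge_atTop (n + 1)] with m hm
    obtain ⟨y, hy⟩ := K.nonempty
    exact ⟨S.word s m y, S.image_word_subset_iterate s m K (mem_image_of_mem _ hy),
      hn (hword hm (mem_image_of_mem _ (hK hy)))⟩

theorem TopologicallyContracting.exists_isAttractor [Nonempty X] {S : IFS X k}
    (hS : S.TopologicallyContracting) : ∃ A, S.IsAttractor A := by
  let K₀ : NonemptyCompacts X := {Classical.arbitrary X}
  obtain ⟨D₀, -, hD₀⟩ := hS.1 K₀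
  obtain ⟨A, hinv, hA⟩ := hS.exists_tendsto_of_subset hD₀
  refine ⟨A, hinv.symm, fun K => ?_⟩
  -- The limit does not depend on the dominating set: inside `D`, the orbits of `K` and `D₀` share
  -- one limit, which for `D₀` is `A`.
  obtain ⟨D, hKD, hD⟩ := hS.1 (K ⊔ D₀)
  rw [NonemptyCompacts.coe_sup, union_subset_iff] at hKD
  obtain ⟨B, -, hB⟩ := hS.exists_tendsto_of_subset hD
  rw [tendsto_nhds_unique (hA D₀ Subset.rfl) (hB D₀ hKD.2)]
  exact hB K hKD.1

theorem IsAttractor.unique {S : IFS X k} {A B : NonemptyCompacts X} (hA : S.IsAttractor A)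
    (hB : S.IsAttractor B) : A = B :=
  tendsto_nhds_unique (hA.2 A) (hB.2 A)

end IFS

theorem charFun_eq_one {X : Type*} {C : Set X} {x : X} (hx : x ∈ C) : charFun C x = 1 :=
  indicator_of_mem hx _

theorem charFun_eq_zero {X : Type*} {C : Set X} {x : X} (hx : x ∉ C) : charFun C x = 0 :=
  indicator_of_notMem hx _

theorem pos_charFun_iff {X : Type*} {C : Set X} {x : X} : 0 < charFun C x ↔ x ∈ C := by
  by_cases hx : x ∈ C <;> simp [charFun, hx]

/-! ### Hypographs and the `h`-topology -/

namespace CompactFuzzySet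

variable {X : Type*} [TopologicalSpace X]

theorem toFun_injective : Function.Injective (toFun : CompactFuzzySet X → X → I) := by
  rintro ⟨u, _, _, _⟩ ⟨v, _, _, _⟩ rfl
  rfl

theorem mem_hypo {u : CompactFuzzySet X} {p : X × I} :
    p ∈ (u.hypo : Set (X × I)) ↔ p.1 ∈ u.support ∧ p.2 ≤ u.toFun p.1 :=
  Iff.rfl

theorem hypo_injective : Function.Injective (hypo : CompactFuzzySet X → _) := by
  have key : ∀ u v : CompactFuzzySet X, u.hypo = v.hypo → ∀ x, u.toFun x ≤ v.toFun x := by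
    intro u v h x
    rcases eq_bot_or_bot_lt (u.toFun x) with h0 | h0
    · exact h0 ▸ bot_le
    · have hx : (x, u.toFun x) ∈ (u.hypo : Set (X × I)) := mem_hypo.2 ⟨subset_closure h0, le_rfl⟩
      rw [h] at hx
      exact hx.2
  exact fun u v h => toFun_injective (funext fun x => (key u v h x).antisymm (key v u h.symm x))

instance [T2Space X] : T2Space (CompactFuzzySet X) :=
  (Topology.IsEmbedding.mk ⟨rfl⟩ hypo_injective).t2Space

/-- The characteristic function of a nonempty compact set, as a compact fuzzy set. -/
noncomputable def ofNonemptyCompacts [T2Space X] (A : NonemptyCompacts X) : CompactFuzzySet X where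
  toFun := charFun A
  normal := A.nonempty.imp fun _ => charFun_eq_one
  usc := A.isCompact.isClosed.upperSemicontinuous_indicator zero_le_one
  compact_support := by
    simp only [pos_charFun_iff]
    exact A.isCompact.closure

variable [T2Space X]

theorem hypo_ofNonemptyCompacts (A : NonemptyCompacts X) :
    (ofNonemptyCompacts A).hypo = A ×ˢ (⊤ : NonemptyCompacts I) := by
  refine SetLike.coe_injective (Set.ext fun p => ?_)
  have hs : (ofNonemptyCompacts A).support = A := by
    simp only [support, ofNonemptyCompacts, pos_charFun_iff]
    exact A.isCompact.isClosed.closure_eq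
  rw [mem_hypo, hs, NonemptyCompacts.coe_prod, mem_prod]
  refine and_congr_right fun hp => iff_of_true ?_ (mem_univ _)
  exact p.2.2.2.trans_eq (congrArg Subtype.val (charFun_eq_one hp)).symm

end CompactFuzzySet

/-! ### The weak fuzzy attractor -/

namespace FuzzyIFS

variable {X : Type*} [TopologicalSpace X] [T2Space X] {k : ℕ} (S : FuzzyIFS X k)

theorem IsWeakFuzzyAttractor.unique {S : FuzzyIFS X k} {u v : CompactFuzzySet X}
    (hu : S.IsWeakFuzzyAttractor u) (hv : S.IsWeakFuzzyAttractor v) : u = v :=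
  tendsto_nhds_unique (hu.2 u) (hv.2 u)

variable [NeZero k]

theorem support_hutchinson_subset (u : CompactFuzzySet X) {K : NonemptyCompacts X}
    (hK : u.support ⊆ K) : (S.hutchinson u).support ⊆ S.toIFS.hutchinson K := by
  refine closure_minimal (fun y hy => ?_) (S.toIFS.hutchinson K).isCompact.isClosed
  obtain ⟨i, x, hx, h⟩ := (S.le_hutchinsonFun_iff u hy y).1 le_rfl
  exact IFS.mem_hutchinson.2 ⟨i, x, hK (S.subset_support_of_grey u hy i h), hx⟩

theorem support_hutchinson_iterate_subset (u : CompactFuzzySet X) {K : NonemptyCompacts X}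
    (hK : u.support ⊆ K) (n : ℕ) : (S.hutchinson^[n] u).support ⊆ S.toIFS.hutchinson^[n] K := by
  induction n with
  | zero => exact hK
  | succ n ih =>
    simp only [Function.iterate_succ_apply']
    exact S.support_hutchinson_subset _ ih

/-- Here it matters that all grey level maps fix `1`: with only one doing so, height `1` could be
lost along the other maps. -/
theorem hutchinson_eq_one (hρ : ∀ i, S.grey i 1 = 1) (u : CompactFuzzySet X)
    {K : NonemptyCompacts X} (hK : ∀ x ∈ K, u.toFun x = 1) {y : X} (hy : y ∈ S.toIFS.hutchinson K) :
    (S.hutchinson u).toFun y = 1 := by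
  obtain ⟨i, x, hx, hxy⟩ := IFS.mem_hutchinson.1 hy
  refine le_antisymm le_one' ((S.le_hutchinsonFun_iff u zero_lt_one y).2 ⟨i, x, hxy, ?_⟩)
  rw [hK x hx, hρ]

theorem hutchinson_iterate_eq_one (hρ : ∀ i, S.grey i 1 = 1) (u : CompactFuzzySet X)
    {K : NonemptyCompacts X} (hK : ∀ x ∈ K, u.toFun x = 1) (n : ℕ) :
    ∀ y ∈ S.toIFS.hutchinson^[n] K, (S.hutchinson^[n] u).toFun y = 1 := by
  induction n with
  | zero => exact hK
  | succ n ih =>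
    simp only [Function.iterate_succ_apply']
    exact fun y hy => S.hutchinson_eq_one hρ _ ih hy

theorem hutchinson_ofNonemptyCompacts (hρ : ∀ i, S.grey i 1 = 1) (A : NonemptyCompacts X) :
    S.hutchinson (.ofNonemptyCompacts A) = .ofNonemptyCompacts (S.toIFS.hutchinson A) := by
  refine CompactFuzzySet.toFun_injective (funext fun y => ?_)
  by_cases hy : y ∈ (S.toIFS.hutchinson A : Set X)
  · rw [S.hutchinson_eq_one hρ _ (fun x hx => charFun_eq_one hx) hy]
    exact (charFun_eq_one hy).symm
  · refine (Eq.trans ?_ (charFun_eq_zero hy).symm)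
    by_contra hne
    have hpos : 0 < S.hutchinsonFun (CompactFuzzySet.ofNonemptyCompacts A).toFun y :=
      unitInterval.pos_iff_ne_zero.2 hne
    obtain ⟨i, x, hx, h⟩ := (S.le_hutchinsonFun_iff _ hpos y).1 le_rfl
    refine hy (IFS.mem_hutchinson.2 ⟨i, x, by_contra fun hxA => ?_, hx⟩)
    have h0 : (CompactFuzzySet.ofNonemptyCompacts A).toFun x = 0 :=
      charFun_eq_zero hxA
    rw [h0, S.grey_zero] at h
    exact absurd h (not_le.2 hpos)

/-- The hypographs of the iterates lie between the cylinders over the iterates of a point of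
height `1` and over the iterates of the support. -/
theorem isWeakFuzzyAttractor_of_isAttractor (hρ : ∀ i, S.grey i 1 = 1) {A : NonemptyCompacts X}
    (hA : S.toIFS.IsAttractor A) : S.IsWeakFuzzyAttractor (.ofNonemptyCompacts A) := by
  refine ⟨by rw [S.hutchinson_ofNonemptyCompacts hρ, ← hA.1], fun v => ?_⟩
  obtain ⟨x, hx⟩ := v.normal
  let K₁ : NonemptyCompacts X := {x}
  let K₂ : NonemptyCompacts X :=
    ⟨⟨v.support, v.compact_support⟩, x, subset_closure (hx ▸ zero_lt_one : 0 < v.toFun x)⟩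
  have hone := S.hutchinson_iterate_eq_one hρ v (K := K₁) fun y hy => by
    rw [show y = x from hy, hx]
  have hcyl : ∀ K : NonemptyCompacts X,
      Tendsto (fun n : ℕ => (S.toIFS.hutchinson^[n] K) ×ˢ (⊤ : NonemptyCompacts I)) atTop
        (𝓝 (A ×ˢ (⊤ : NonemptyCompacts I))) := fun K =>
    (NonemptyCompacts.continuous_prod.tendsto (A, ⊤)).comp ((hA.2 K).prodMk_nhds tendsto_const_nhds)
  rw [nhds_induced, tendsto_comap_iff, CompactFuzzySet.hypo_ofNonemptyCompacts]
  refine tendsto_nonemptyCompacts_of_subset_of_subset (hcyl K₁) (hcyl K₂) (fun n p hp => ?_)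
    fun n p hp => ?_
  -- Height `1` at `p.1` puts the whole segment over `p.1` into the hypograph.
  · rw [NonemptyCompacts.coe_prod] at hp
    have h1 := hone n p.1 hp.1
    refine CompactFuzzySet.mem_hypo.2 ⟨subset_closure ?_, ?_⟩
    · exact zero_lt_one.trans_eq h1.symm
    · exact le_one'.trans_eq h1.symm
  · rw [NonemptyCompacts.coe_prod]
    exact ⟨S.support_hutchinson_iterate_subset v (K := K₂) Subset.rfl n hp.1, mem_univ _⟩

end FuzzyIFS

end FuzzyIFSTheory

theorem mainTheorem9 {X : Type*} [TopologicalSpace X] [T2Space X] [Nonempty X] {k : ℕ} [NeZero k]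
    (S : FuzzyIFSTheory.FuzzyIFS X k) (hS : S.toIFS.TopologicallyContracting)
    (hρ : ∀ i, S.grey i 1 = 1) :
    (∃! A : TopologicalSpace.NonemptyCompacts X, S.toIFS.IsAttractor A) ∧
    (∃! u : FuzzyIFSTheory.CompactFuzzySet X, S.IsWeakFuzzyAttractor u) ∧
    ∀ (A : TopologicalSpace.NonemptyCompacts X) (u : FuzzyIFSTheory.CompactFuzzySet X),
      S.toIFS.IsAttractor A → S.IsWeakFuzzyAttractor u →
        u.toFun = FuzzyIFSTheory.charFun (A : Set X) := by
  obtain ⟨A₀, hA₀⟩ := hS.exists_isAttractor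
  have hu₀ := S.isWeakFuzzyAttractor_of_isAttractor hρ hA₀
  refine ⟨⟨A₀, hA₀, fun B hB => hB.unique hA₀⟩, ⟨_, hu₀, fun v hv => hv.unique hu₀⟩, ?_⟩
  intro A u hA hu
  rw [hu.unique hu₀, hA.unique hA₀]
  rfl
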